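/- Let $2^\omega$ be Cantor space with uniform measure $\lambda$, so $\lambda[\sigma]=2^{-|\sigma|}$ for each binary string $\sigma$, where $[\sigma]=\{Z\in 2^\omega : Z\succ\sigma\}$. Let $\mathcal M(2^\omega)$ be the space of Borel probability measures on $2^\omega$, with the effective basis of open sets consisting of the sets of all $\mu$ satisfying finitely many conditions of the form $q<\mu[\sigma]$ or $\mu[\sigma]<q$ with $\sigma$ a binary string and $q$ a nonnegative rational. Let $\mathbb P$ be the natural probability measure on $\mathcal M(2^\omega)$ (of Mauldin–Monticino and Culver): it is the law of the random measure $\mu$ obtained by choosing, independently for each string $\sigma$, a number $U_\sigma$ uniformly distributed in $[0,1]$ and setting $\mu[\sigma 0]=U_\sigma\,\mu[\sigma]$, $\mu[\sigma 1]=(1-U_\sigma)\,\mu[\sigma]$, with $\mu(2^\omega)=1$. (So, given $\mu[\sigma]=s$, the value $\mu[\sigma 0]$ is uniformly distributed in $[0,s]$.) In a space with an effective basis and a measure $\nu$, a Martin-Löf test with respect to $\nu$ is a sequence $(G_m)_{m\in\mathbb N}$ of uniformly $\Sigma^0_1$ sets (uniformly computably enumerable unions of basic open sets) such that $\nu(G_m)\le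 2^{-m}$ for each $m$; a point is Martin-Löf random with respect to $\nu$ if it lies in $\bigcap_m G_m$ for no such test. A probability measure $\mu$ on $2^\omega$ is Martin-Löf absolutely continuous if $\inf_m \mu(G_m)=0$ for each Martin-Löf test $(G_m)$ on $2^\omega$ with respect to $\lambda$. Then: 1. $\int \mu(G)\,d\mathbb P(\mu)=\lambda(G)$ for every open set $G\subseteq 2^\omega$. 2. Every probability measure $\mu$ on $2^\omega$ that is Martin-Löf random with respect to $\mathbb P$ is Martin-Löf absolutely continuous. -/

import Mathlib

open MeasureTheory Set

open scoped ENNReal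

noncomputable section

namespace CantorRandom

/-! ### Effectively open sets, Martin-Löf tests and Martin-Löf randomness

`B : ι → Set X` is a basis of open sets of a space `X`, indexed by a set `ι` of codes. -/

/-- `G` is a uniformly `Σ⁰₁` sequence of sets: there is one computably enumerable set of pairs
`(m, i)` such that `G m` is the union of the basic sets whose code `i` is enumerated with `m`. -/
def UniformlySigma1 {X ι : Type*} [Primcodable ι] (B : ι → Set X) (G : ℕ → Set X) : Prop :=
  ∃ W : ℕ × ι → Prop, REPred W ∧ ∀ m, G m = ⋃ i, ⋃ (_ : W (m, i)), B i

/-- Martin-Löf tests with respect to a measure `ν`. -/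
def IsMLTest {X ι : Type*} [Primcodable ι] [MeasurableSpace X] (B : ι → Set X) (ν : Measure X)
    (G : ℕ → Set X) : Prop :=
  UniformlySigma1 B G ∧ ∀ m : ℕ, ν (G m) ≤ (2 : ℝ≥0∞)⁻¹ ^ m

/-- `x` is Martin-Löf random with respect to `ν`: it passes every Martin-Löf test. -/
def IsMLRandom {X ι : Type*} [Primcodable ι] [MeasurableSpace X] (B : ι → Set X) (ν : Measure X)
    (x : X) : Prop :=
  ∀ G : ℕ → Set X, IsMLTest B ν G → x ∉ ⋂ m, G m

/-! ### Cantor space -/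

/-- Cantor space `2^ω`; `false` is the bit `0` and `true` is the bit `1`. -/
abbrev Cantor : Type := ℕ → Bool

/-- The basic clopen set `[σ]` of all sequences extending the string `σ`. -/
def cyl (σ : List Bool) : Set Cantor := {Z | ∀ (i : ℕ) (h : i < σ.length), Z i = σ[i]}

/-- The uniform measure `λ` on Cantor space (independent fair bits). -/
def uniformMeasure : Measure Cantor :=
  Measure.infinitePi fun _ : ℕ => (PMF.uniformOfFintype Bool).toMeasure

/-- Martin-Löf absolute continuity of a measure on Cantor space. -/
def IsMLAbsolutelyContinuous (μ : Measure Cantor) : Prop :=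
  ∀ G : ℕ → Set Cantor, IsMLTest cyl uniformMeasure G → ⨅ m, μ (G m) = 0

/-! ### The natural measure on the space of probability measures on Cantor space

Independently for each string `σ` draw `U σ` uniformly from `[0, 1]`. The random measure is the one
that gives the fraction `U σ` of the mass of `[σ]` to `[σ0]` and the rest to `[σ1]`; that is, given
the mass `s` of `[σ]`, the mass of `[σ0]` is uniformly distributed in `[0, s]`. For fixed `U`, this
measure is realised as the law of the random sequence that, after the initial segment `σ`, continues
with the bit `0` with probability `U σ`. -/

/-- The first `n` bits of the sequence obtained from the splitting ratios `U` and the sample points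
`V`: after the string `σ` of length `k`, the next bit is `0` iff `V k < U σ`. -/
def run (U : List Bool → unitInterval) (V : ℕ → unitInterval) : ℕ → List Bool
  | 0 => []
  | n + 1 => run U V n ++ [decide (U (run U V n) ≤ V n)]

/-- The infinite sequence of which `run U V n` is the initial segment of length `n`. -/
def runSeq (U : List Bool → unitInterval) (V : ℕ → unitInterval) : Cantor :=
  fun n => decide (U (run U V n) ≤ V n)

theorem measurableSet_run (n : ℕ) (σ : List Bool) :
    MeasurableSet {p : (List Bool → unitInterval) × (ℕ → unitInterval) | run p.1 p.2 n = σ} := by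
  induction n generalizing σ with
  | zero => simp [run]
  | succ n ih =>
    have : {p : (List Bool → unitInterval) × (ℕ → unitInterval) | run p.1 p.2 (n + 1) = σ} =
        ⋃ τ : List Bool, {p | run p.1 p.2 n = τ} ∩ {p | τ ++ [decide (p.1 τ ≤ p.2 n)] = σ} := by
      ext p; simp [run]
    rw [this]
    refine MeasurableSet.iUnion fun τ => (ih τ).inter ?_
    have hm : MeasurableSet {p : (List Bool → unitInterval) × (ℕ → unitInterval) |
        p.1 τ ≤ p.2 n} := measurableSet_le (by fun_prop) (by fun_prop)
    have : {p : (List Bool → unitInterval) × (ℕ → unitInterval) |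
        τ ++ [decide (p.1 τ ≤ p.2 n)] = σ} =
        ({p | p.1 τ ≤ p.2 n} ∩ {_p | τ ++ [true] = σ}) ∪
        ({p | p.1 τ ≤ p.2 n}ᶜ ∩ {_p | τ ++ [false] = σ}) := by
      ext p
      by_cases h : p.1 τ ≤ p.2 n <;> simp [h]
    rw [this]
    exact (hm.inter (.const _)).union (hm.compl.inter (.const _))

theorem measurable_runSeq :
    Measurable fun p : (List Bool → unitInterval) × (ℕ → unitInterval) => runSeq p.1 p.2 := by
  refine measurable_pi_lambda _ fun n => measurable_to_bool ?_
  have : (fun p : (List Bool → unitInterval) × (ℕ → unitInterval) => runSeq p.1 p.2 n) ⁻¹' {true} =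
      ⋃ τ : List Bool, {p | run p.1 p.2 n = τ} ∩ {p | p.1 τ ≤ p.2 n} := by
    ext p; simp [runSeq]
  rw [this]
  exact MeasurableSet.iUnion fun τ => (measurableSet_run n τ).inter
    (measurableSet_le (by fun_prop) (by fun_prop))

/-- The probability measure on Cantor space with splitting ratios `U`. -/
def splitMeasure (U : List Bool → unitInterval) : ProbabilityMeasure Cantor :=
  ⟨(Measure.infinitePi fun _ : ℕ => (volume : Measure unitInterval)).map (runSeq U),
    Measure.isProbabilityMeasure_map
      (measurable_runSeq.comp measurable_prodMk_left).aemeasurable⟩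

theorem measurable_splitMeasure : Measurable splitMeasure := by
  refine Measurable.subtype_mk (Measure.measurable_of_measurable_coe _ fun s hs => ?_)
  have h : ∀ U : List Bool → unitInterval,
      (Measure.infinitePi fun _ : ℕ => (volume : Measure unitInterval)).map (runSeq U) s =
      (Measure.infinitePi fun _ : ℕ => (volume : Measure unitInterval))
        (Prod.mk U ⁻¹' ((fun p : (List Bool → unitInterval) × (ℕ → unitInterval) =>
          runSeq p.1 p.2) ⁻¹' s)) := fun U => by
    have hU : Measurable (runSeq U) := measurable_runSeq.comp measurable_prodMk_left
    rw [Measure.map_apply hU hs]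
    rfl
  simp_rw [h]
  exact measurable_measure_prodMk_left (measurable_runSeq hs)

theorem runSeq_mem_cyl_iff (U : List Bool → unitInterval) (V : ℕ → unitInterval) (σ : List Bool) :
    runSeq U V ∈ cyl σ ↔
      ∀ (i : ℕ) (h : i < σ.length), decide (U (σ.take i) ≤ V i) = σ[i] := by
  have key : ∀ n ≤ σ.length, (∀ i (h : i < σ.length), i < n → runSeq U V i = σ[i]) →
      run U V n = σ.take n := by
    intro n
    induction n with
    | zero => intro _ _; simp [run]
    | succ n ih =>
      intro hn H
      have h1 := ih (by omega) fun i h hi => H i h (by omega)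
      have h2 := H n (by omega) (by omega)
      rw [runSeq] at h2
      rw [run, h2, h1, List.take_append_getElem]
  have key' : ∀ n ≤ σ.length,
      (∀ i (h : i < σ.length), i < n → decide (U (σ.take i) ≤ V i) = σ[i]) →
      run U V n = σ.take n := by
    intro n
    induction n with
    | zero => intro _ _; simp [run]
    | succ n ih =>
      intro hn H
      have h1 := ih (by omega) fun i h hi => H i h (by omega)
      have h2 := H n (by omega) (by omega)
      rw [run, h1, h2, List.take_append_getElem]
  constructor
  · intro H i h
    rw [← key i h.le fun j hj _ => H j hj]
    exact H i h
  · intro H i h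
    rw [runSeq, key' i h.le fun j hj _ => H j hj]
    exact H i h

theorem splitMeasure_cyl (U : List Bool → unitInterval) (σ : List Bool) :
    (splitMeasure U : Measure Cantor) (cyl σ) = ∏ i ∈ Finset.range σ.length,
      if σ.getD i false then ENNReal.ofReal (1 - U (σ.take i))
      else ENNReal.ofReal (U (σ.take i)) := by
  have hU : Measurable (runSeq U) := measurable_runSeq.comp measurable_prodMk_left
  have hc : MeasurableSet (cyl σ) := by
    have : cyl σ = ⋂ (i : ℕ) (h : i < σ.length), (fun Z : Cantor => Z i) ⁻¹' {σ[i]} := by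
      ext Z; simp [cyl]
    rw [this]
    exact MeasurableSet.iInter fun i => MeasurableSet.iInter fun _ =>
      measurable_pi_apply i (MeasurableSet.singleton _)
  change (Measure.infinitePi fun _ : ℕ => (volume : Measure unitInterval)).map (runSeq U)
    (cyl σ) = _
  rw [Measure.map_apply hU hc]
  have : runSeq U ⁻¹' cyl σ = Set.pi (Finset.range σ.length : Set ℕ)
      fun i => if σ.getD i false then Set.Ici (U (σ.take i)) else Set.Iio (U (σ.take i)) := by
    ext V
    simp only [mem_preimage, runSeq_mem_cyl_iff, Set.mem_pi, Finset.coe_range, mem_Iio]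
    refine forall_congr' fun i => forall_congr' fun h => ?_
    rw [List.getD_eq_getElem _ _ h]
    cases σ[i] <;> simp
  rw [this, Measure.infinitePi_pi _ fun i _ => by split_ifs <;> measurability]
  refine Finset.prod_congr rfl fun i _ => ?_
  split_ifs <;> simp

theorem splitMeasure_nil (U : List Bool → unitInterval) :
    (splitMeasure U : Measure Cantor) (cyl []) = 1 := by
  simp [splitMeasure_cyl]

/-- `splitMeasure U` gives the fraction `U σ` of the mass of `[σ]` to `[σ0]`. -/
theorem splitMeasure_append_false (U : List Bool → unitInterval) (σ : List Bool) :
    (splitMeasure U : Measure Cantor) (cyl (σ ++ [false])) =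
      ENNReal.ofReal (U σ) * (splitMeasure U : Measure Cantor) (cyl σ) := by
  rw [splitMeasure_cyl, splitMeasure_cyl, List.length_append, List.length_singleton,
    Finset.prod_range_succ, mul_comm]
  congr 1
  · simp
  · refine Finset.prod_congr rfl fun i hi => ?_
    have hi : i < σ.length := by simpa using hi
    rw [List.getD_append _ _ _ _ hi, List.take_append_of_le_length hi.le]

/-- `splitMeasure U` gives the fraction `1 - U σ` of the mass of `[σ]` to `[σ1]`. -/
theorem splitMeasure_append_true (U : List Bool → unitInterval) (σ : List Bool) :
    (splitMeasure U : Measure Cantor) (cyl (σ ++ [true])) =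
      ENNReal.ofReal (1 - U σ) * (splitMeasure U : Measure Cantor) (cyl σ) := by
  rw [splitMeasure_cyl, splitMeasure_cyl, List.length_append, List.length_singleton,
    Finset.prod_range_succ, mul_comm]
  congr 1
  · simp
  · refine Finset.prod_congr rfl fun i hi => ?_
    have hi : i < σ.length := by simpa using hi
    rw [List.getD_append _ _ _ _ hi, List.take_append_of_le_length hi.le]

/-- The natural measure `ℙ` on the space of probability measures on Cantor space: the law of
`splitMeasure U` where the `U σ` are independent and uniformly distributed in `[0, 1]`. -/
def naturalMeasure : Measure (ProbabilityMeasure Cantor) :=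
  (Measure.infinitePi fun _ : List Bool => (volume : Measure unitInterval)).map splitMeasure

instance : IsProbabilityMeasure naturalMeasure :=
  Measure.isProbabilityMeasure_map measurable_splitMeasure.aemeasurable

/-- The effective basis of the (weak) topology on the space of probability measures: a code is a
finite list of quadruples `(σ, b, p, k)`, each standing for the condition `p / (k + 1) < μ [σ]` if
`b` is `true`, and `μ [σ] < p / (k + 1)` if `b` is `false`; it describes the set of all `μ` that
satisfy the conditions on the list. -/
def basicOpen (L : List (List Bool × Bool × ℕ × ℕ)) : Set (ProbabilityMeasure Cantor) :=
  {μ | ∀ c ∈ L,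
    if c.2.1 then (c.2.2.1 : ℝ) / (c.2.2.2 + 1) < (μ : Measure Cantor).real (cyl c.1)
    else (μ : Measure Cantor).real (cyl c.1) < (c.2.2.1 : ℝ) / (c.2.2.2 + 1)}

end CantorRandom

end

open MeasureTheory Set

open scoped ENNReal

namespace CantorRandom

/-! Under `naturalMeasure`, the mass of `cyl σ` is a product of independent factors `U τ` or `1 - U
τ` over the proper prefixes `τ` of `σ`, each of mean 1/2. So the mean of `μ` agrees with λ on
cylinders, hence on open sets (`lintegral_naturalMeasure`). If `μ` is not Martin-Löf absolutely
continuous, some λ-test `G` and some `k` satisfy `2⁻¹ ^ k < μ (G m)` for all `m`. By Markov's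
inequality the set of such measures for `G (m + k)` has ℙ-measure at most `2 ^ k * 2⁻¹ ^ (m + k) =
2⁻¹ ^ m`. These sets are uniformly Σ⁰₁ (`UniformlySigma1.setOf_lt`), because the inequality is
witnessed by finitely many rational lower bounds on disjoint cylinders. They form a ℙ-test capturing
`μ`. -/

/-! ### Stages and projections of computably enumerable predicates -/

theorem _root_.REPred.exists_stages {α : Type*} [Primcodable α] {p : α → Prop} (hp : REPred p) :
    ∃ E : ℕ → α → Prop, PrimrecRel E ∧ (∀ {s t a}, s ≤ t → E s a → E t a) ∧
      ∀ a, p a ↔ ∃ s, E s a := by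
  obtain ⟨c, hc⟩ := Nat.Partrec.Code.exists_code.1 hp
  -- Stage `s` is a run of a code for `p` with bound `s`.
  refine ⟨fun s a => (c.evaln s (Encodable.encode a)).isSome = true, ?_, ?_, fun a => ?_⟩
  · have h : Primrec fun x : ℕ × α => c.evaln x.1 (Encodable.encode x.2) :=
      Nat.Partrec.Code.primrec_evaln.comp
        ((Primrec.fst.pair (Primrec.const c)).pair (Primrec.encode.comp Primrec.snd))
    exact PrimrecRel.comp Primrec.eq (Primrec.option_isSome.comp h) (Primrec.const true)
  · intro s t a hst h
    obtain ⟨x, hx⟩ := Option.isSome_iff_exists.1 h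
    exact Option.isSome_iff_exists.2 ⟨x, Nat.Partrec.Code.evaln_mono hst hx⟩
  · have h : p a ↔ ∃ x, x ∈ c.eval (Encodable.encode a) := by
      rw [hc]; simp
    rw [h]
    simp only [Nat.Partrec.Code.evaln_complete, Option.isSome_iff_exists, Option.mem_def]
    exact exists_comm

/-- Unbounded search through the codes of elements of `β` halts exactly when a witness exists. -/
theorem _root_.PrimrecPred.rePred_exists {α β : Type*} [Primcodable α] [Primcodable β]
    {p : α × β → Prop} (hp : PrimrecPred p) : REPred fun a => ∃ b, p (a, b) := by
  classical
  obtain ⟨_, hd⟩ := hp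
  have h : Primrec fun x : α × ℕ => ((Encodable.decode x.2 : Option β).bind fun b =>
      if p (x.1, b) then some () else none) := by
    refine Primrec.option_bind (Primrec.decode.comp Primrec.snd) (Primrec.ite ?_
      (Primrec.const _) (Primrec.const _))
    exact PrimrecPred.comp (p := p) ⟨_, hd⟩
      ((Primrec.fst.comp Primrec.fst).pair Primrec.snd)
  refine (Partrec.rfindOpt (f := fun a n => ((Encodable.decode n : Option β).bind fun b =>
      if p (a, b) then some () else none)) h.to_comp).dom_re.of_eq fun a => ?_
  rw [Nat.rfindOpt_dom]
  constructor
  · rintro ⟨n, _, h⟩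
    obtain ⟨b, -, hb⟩ := Option.bind_eq_some_iff.1 h
    refine ⟨b, ?_⟩
    by_contra hn
    simp [hn] at hb
  · rintro ⟨b, hb⟩
    exact ⟨Encodable.encode b, (), by simp [hb]⟩

/-! ### Cylinders -/

theorem isOpen_cyl (σ : List Bool) : IsOpen (cyl σ) := by
  have : cyl σ = ⋂ i : Fin σ.length, (fun Z : Cantor => Z i) ⁻¹' {σ[i]} := by
    ext Z
    simp [cyl, Fin.forall_iff]
  rw [this]
  exact isOpen_iInter_of_finite fun i => (isOpen_discrete _).preimage (continuous_apply _)

theorem measurableSet_cyl (σ : List Bool) : MeasurableSet (cyl σ) := (isOpen_cyl σ).measurableSet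

/-- The first `n` bits of a sequence. -/
def initSeg (Z : Cantor) (n : ℕ) : List Bool := List.ofFn fun i : Fin n => Z i

@[simp] theorem length_initSeg (Z : Cantor) (n : ℕ) : (initSeg Z n).length = n := by
  simp [initSeg]

theorem mem_cyl_initSeg (Z : Cantor) (n : ℕ) : Z ∈ cyl (initSeg Z n) := by
  intro i h
  simp [initSeg]

theorem mem_cyl_iff {Z : Cantor} {σ : List Bool} : Z ∈ cyl σ ↔ initSeg Z σ.length = σ := by
  constructor
  · intro h
    refine List.ext_getElem (by simp) fun i h1 h2 => ?_
    simpa [initSeg] using h i h2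
  · intro h
    rw [← h]
    exact mem_cyl_initSeg _ _

theorem initSeg_take (Z : Cantor) {m n : ℕ} (h : m ≤ n) : (initSeg Z n).take m = initSeg Z m :=
  List.ext_getElem (by simp [h]) fun i h1 h2 => by simp [initSeg]

theorem cyl_subset_cyl_take (σ : List Bool) (i : ℕ) : cyl σ ⊆ cyl (σ.take i) := by
  intro Z hZ j hj
  rw [List.getElem_take]
  exact hZ j (by simp at hj; omega)

theorem pairwiseDisjoint_cyl (n : ℕ) : {σ : List Bool | σ.length = n}.PairwiseDisjoint cyl := by
  intro σ hσ τ hτ hne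
  refine Set.disjoint_left.2 fun Z h1 h2 => hne ?_
  rw [mem_cyl_iff] at h1 h2
  rw [← h1, ← h2, hσ, hτ]

open Classical in
/-- The strings of length `n` in `A`. -/
noncomputable def stringsIn (A : Set (List Bool)) (n : ℕ) : Finset (List Bool) :=
  ((Finset.univ : Finset (Fin n → Bool)).image List.ofFn).filter (· ∈ A)

theorem mem_stringsIn {A : Set (List Bool)} {n : ℕ} {σ : List Bool} :
    σ ∈ stringsIn A n ↔ σ.length = n ∧ σ ∈ A := by
  simp only [stringsIn, Finset.mem_filter, Finset.mem_image, Finset.mem_univ, true_and]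
  refine and_congr_left fun _ => ⟨?_, ?_⟩
  · rintro ⟨f, rfl⟩
    simp
  · rintro rfl
    exact ⟨fun i => σ[i], by simp⟩

theorem measure_biUnion_cyl (μ : Measure Cantor) {S : Finset (List Bool)} {n : ℕ}
    (hS : ∀ σ ∈ S, σ.length = n) : μ (⋃ σ ∈ S, cyl σ) = ∑ σ ∈ S, μ (cyl σ) :=
  measure_biUnion_finset ((pairwiseDisjoint_cyl n).subset hS) fun σ _ => measurableSet_cyl σ

/-- Closure of `A` under extension makes the unions over length `n` increase with `n`; each is a
disjoint union, so continuity from below applies. -/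
theorem measure_iUnion_cyl (μ : Measure Cantor) {A : Set (List Bool)}
    (hA : ∀ (σ : List Bool) (i : ℕ), σ.take i ∈ A → σ ∈ A) :
    μ (⋃ σ ∈ A, cyl σ) = ⨆ n, ∑ σ ∈ stringsIn A n, μ (cyl σ) := by
  have hmono : Monotone fun n => ⋃ σ ∈ stringsIn A n, cyl σ := by
    intro m n hmn Z hZ
    simp only [mem_iUnion, mem_stringsIn, exists_prop] at hZ ⊢
    obtain ⟨σ, ⟨hσ, hσA⟩, hZσ⟩ := hZ
    refine ⟨initSeg Z n, ⟨by simp, hA _ m ?_⟩, mem_cyl_initSeg _ _⟩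
    rw [mem_cyl_iff, hσ] at hZσ
    rwa [initSeg_take _ hmn, hZσ]
  have hU : ⋃ σ ∈ A, cyl σ = ⋃ n, ⋃ σ ∈ stringsIn A n, cyl σ := by
    ext Z
    simp only [mem_iUnion, mem_stringsIn, exists_prop]
    exact ⟨fun ⟨σ, h, hZ⟩ => ⟨_, σ, ⟨rfl, h⟩, hZ⟩, fun ⟨_, σ, ⟨_, h⟩, hZ⟩ => ⟨σ, h, hZ⟩⟩
  rw [hU, hmono.measure_iUnion]
  exact iSup_congr fun n => measure_biUnion_cyl μ fun σ h => (mem_stringsIn.1 h).1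

theorem IsOpen.eq_iUnion_cyl {G : Set Cantor} (hG : IsOpen G) :
    G = ⋃ σ ∈ {σ | cyl σ ⊆ G}, cyl σ := by
  refine subset_antisymm (fun Z hZ => ?_) (iUnion₂_subset fun σ h => h)
  obtain ⟨I, u, hu, hsub⟩ := isOpen_pi_iff.1 hG Z hZ
  obtain ⟨n, hn⟩ := I.exists_le
  -- Length `n + 1`, since the coordinate `n` itself may be in `I`.
  refine mem_iUnion₂.2 ⟨initSeg Z (n + 1), fun Y hY => hsub fun i hi => ?_, mem_cyl_initSeg _ _⟩
  have h := hY i (by simpa using Nat.lt_succ_of_le (hn i hi))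
  simp only [initSeg, List.getElem_ofFn] at h
  rw [h]
  exact (hu i hi).2

theorem measure_eq_of_cyl {μ ν : Measure Cantor} (h : ∀ σ, μ (cyl σ) = ν (cyl σ))
    {G : Set Cantor} (hG : IsOpen G) : μ G = ν G := by
  have hA : ∀ (σ : List Bool) (i : ℕ), σ.take i ∈ {σ | cyl σ ⊆ G} → σ ∈ {σ | cyl σ ⊆ G} :=
    fun σ i h => (cyl_subset_cyl_take σ i).trans h
  rw [IsOpen.eq_iUnion_cyl hG, measure_iUnion_cyl μ hA, measure_iUnion_cyl ν hA]
  simp_rw [h]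

/-! ### The barycenter of the natural measure -/

theorem uniformMeasure_cyl (σ : List Bool) : uniformMeasure (cyl σ) = 2⁻¹ ^ σ.length := by
  have : cyl σ = Set.pi (Finset.range σ.length : Set ℕ) fun i => {σ.getD i false} := by
    ext Z
    simp only [cyl, mem_ofPred_eq, Set.mem_pi, Finset.coe_range, mem_Iio, mem_singleton_iff]
    refine forall_congr' fun i => forall_congr' fun h => ?_
    rw [List.getD_eq_getElem _ _ h]
  rw [this, uniformMeasure, Measure.infinitePi_pi _ fun i _ => measurableSet_singleton _]
  simp

theorem lintegral_ofReal_unitInterval :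
    ∫⁻ x : unitInterval, ENNReal.ofReal x = 2⁻¹ := by
  rw [← ofReal_integral_eq_lintegral_ofReal]
  · have : ∫ x : unitInterval, (x : ℝ) = ∫ x in Icc (0 : ℝ) 1, x :=
      integral_subtype_comap measurableSet_Icc (fun x => x)
    rw [this, integral_Icc_eq_integral_Ioc, ← intervalIntegral.integral_of_le zero_le_one,
      integral_id]
    norm_num [ENNReal.ofReal_div_of_pos]
  · exact Integrable.of_bound (by fun_prop) 1
      (Filter.Eventually.of_forall fun x => by simpa [abs_of_nonneg x.2.1] using x.2.2)
  · exact Filter.Eventually.of_forall fun x => x.2.1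

theorem lintegral_ofReal_one_sub_unitInterval :
    ∫⁻ x : unitInterval, ENNReal.ofReal (1 - x) = 2⁻¹ := by
  have h : ∫⁻ x : unitInterval, ENNReal.ofReal x + ENNReal.ofReal (1 - x) = 1 := by
    rw [lintegral_congr fun x : unitInterval => by
      rw [← ENNReal.ofReal_add x.2.1 (sub_nonneg.2 x.2.2)]]
    simp
  rw [lintegral_add_left (by fun_prop), lintegral_ofReal_unitInterval] at h
  refine (ENNReal.add_right_inj (a := 2⁻¹) (by simp)).1 ?_
  rw [h, ENNReal.inv_two_add_inv_two]

theorem measurable_apply_naturalMeasure {s : Set Cantor} (hs : MeasurableSet s) :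
    Measurable fun μ : ProbabilityMeasure Cantor => (μ : Measure Cantor) s :=
  (Measure.measurable_coe hs).comp measurable_subtype_coe

theorem lintegral_naturalMeasure_cyl (σ : List Bool) :
    ∫⁻ μ, (μ : Measure Cantor) (cyl σ) ∂naturalMeasure = 2⁻¹ ^ σ.length := by
  rw [naturalMeasure, lintegral_map (measurable_apply_naturalMeasure (measurableSet_cyl σ))
    measurable_splitMeasure]
  simp_rw [splitMeasure_cyl, Finset.prod_range]
  -- Prefixes of different lengths are distinct, so the factors use distinct, hence independent,
  -- coordinates of `U`.
  have hinj : Function.Injective fun i : Fin σ.length => σ.take i := by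
    intro i j h
    have := congrArg List.length h
    simp only [List.length_take] at this
    omega
  have hind := (ProbabilityTheory.iIndepFun_infinitePi
    (P := fun _ : List Bool => (volume : Measure unitInterval))
    (X := fun _ x => x) fun _ => measurable_id).precomp hinj
  let g : Fin σ.length → unitInterval → ℝ≥0∞ := fun i x =>
    if σ.getD i false then ENNReal.ofReal (1 - x) else ENNReal.ofReal x
  have hg : ∀ i, Measurable (g i) := fun i => by
    simp only [g]; split_ifs <;> fun_prop
  have h2 := hind.comp g hg
  have h3 := ProbabilityTheory.lintegral_prod_eq_prod_lintegral_of_indepFun Finset.univ _ h2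
    fun i => (hg i).comp (measurable_pi_apply _)
  refine Eq.trans h3 ?_
  rw [Finset.prod_congr rfl (g := fun _ => 2⁻¹)]
  · simp
  · intro i _
    have := (measurePreserving_eval_infinitePi (fun _ : List Bool =>
      (volume : Measure unitInterval)) (σ.take i)).lintegral_comp (hg i)
    refine Eq.trans this ?_
    simp only [g]
    split_ifs
    · exact lintegral_ofReal_one_sub_unitInterval
    · exact lintegral_ofReal_unitInterval

theorem lintegral_naturalMeasure {G : Set Cantor} (hG : IsOpen G) :
    ∫⁻ μ, (μ : Measure Cantor) G ∂naturalMeasure = uniformMeasure G := by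
  have hm : AEMeasurable (fun μ : ProbabilityMeasure Cantor => (μ : Measure Cantor))
      naturalMeasure := measurable_subtype_coe.aemeasurable
  -- The averages are themselves a measure, so it suffices to compare on cylinders.
  rw [← Measure.bind_apply hG.measurableSet hm]
  refine measure_eq_of_cyl (fun σ => ?_) hG
  rw [Measure.bind_apply (measurableSet_cyl σ) hm, lintegral_naturalMeasure_cyl,
    uniformMeasure_cyl]

/-- Markov's inequality, with the mean given by `lintegral_naturalMeasure`. -/
theorem naturalMeasure_setOf_lt_le {G : Set Cantor} (hG : IsOpen G) (k : ℕ) :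
    naturalMeasure {μ | 2⁻¹ ^ k < (μ : Measure Cantor) G} ≤ 2 ^ k * uniformMeasure G := by
  have h := mul_meas_ge_le_lintegral (μ := naturalMeasure)
    (measurable_apply_naturalMeasure hG.measurableSet) (2⁻¹ ^ k)
  rw [lintegral_naturalMeasure hG] at h
  calc _ ≤ naturalMeasure {μ | 2⁻¹ ^ k ≤ (μ : Measure Cantor) G} :=
        measure_mono (Set.ofPred_subset_ofPred.2 fun μ hμ => hμ.le)
    _ = 2 ^ k * (2⁻¹ ^ k * naturalMeasure {μ | 2⁻¹ ^ k ≤ (μ : Measure Cantor) G}) := by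
        rw [← mul_assoc, ← mul_pow, ENNReal.mul_inv_cancel (by simp) (by simp), one_pow, one_mul]
    _ ≤ _ := by gcongr

/-! ### Effective openness of the condition `2⁻¹ ^ k < μ G` -/

/-- A string, and a lower bound `p / (N + 1)` or an upper bound for its measure. -/
abbrev Condition : Type := List Bool × Bool × ℕ × ℕ

/-- The list `L` of lower bounds with common denominator `N + 1` on distinct strings of length `n`
that are in `A` witnesses that the measure of the union of these cylinders exceeds `2⁻¹ ^ k`. -/
structure IsLowerWitness (k : ℕ) (A : Set (List Bool)) (n N : ℕ) (L : List Condition) : Prop where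
  forall_mem : ∀ c ∈ L, c.2.1 = true ∧ c.1.length = n ∧ c.2.2.2 = N ∧ c.1 ∈ A
  nodup : (L.map Prod.fst).Nodup
  le_sum : N + 1 ≤ 2 ^ k * (L.map fun c => c.2.2.1).sum

/-- Expresses `Nodup` by a bounded quantifier over primitive recursive functions; the default `d` is
never reached. -/
theorem nodup_iff_idxOf_getD {α : Type*} [DecidableEq α] {l : List α} (d : α) :
    l.Nodup ↔ ∀ i < l.length, l.idxOf (l.getD i d) = i := by
  constructor
  · intro h i hi
    rw [List.getD_eq_getElem _ _ hi, h.idxOf_getElem i hi]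
  · intro h
    rw [List.nodup_iff_injective_get]
    intro i j hij
    have hi := h i i.2
    have hj := h j j.2
    rw [List.getD_eq_getElem _ _ i.2] at hi
    rw [List.getD_eq_getElem _ _ j.2] at hj
    simp only [List.get_eq_getElem] at hij
    rw [hij, hj] at hi
    exact Fin.ext hi.symm

theorem primrecPred_nodup {α : Type*} [Primcodable α] [DecidableEq α] (d : α) :
    PrimrecPred fun l : List α => l.Nodup := by
  have h : PrimrecRel fun (i : ℕ) (l : List α) => l.idxOf (l.getD i d) = i :=
    PrimrecRel.comp Primrec.eq (Primrec.list_idxOf.comp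
      ((Primrec.list_getD d).comp Primrec.snd Primrec.fst) Primrec.snd) Primrec.fst
  exact (h.forall_mem_list.comp (Primrec.list_range.comp Primrec.list_length) Primrec.id).of_eq
    fun l => by simp [nodup_iff_idxOf_getD d]

theorem ofReal_inv_two_pow (k : ℕ) : ENNReal.ofReal (2⁻¹ ^ k) = 2⁻¹ ^ k := by
  rw [ENNReal.ofReal_pow (by norm_num), ENNReal.ofReal_inv_of_pos (by norm_num)]
  simp

theorem IsLowerWitness.lt_measure {k : ℕ} {A : Set (List Bool)} {n N : ℕ} {L : List Condition}
    (hL : IsLowerWitness k A n N L) {μ : ProbabilityMeasure Cantor} (hμ : μ ∈ basicOpen L) :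
    2⁻¹ ^ k < (μ : Measure Cantor) (⋃ σ ∈ A, cyl σ) := by
  have hlen : ∀ σ ∈ (L.map Prod.fst).toFinset, σ.length = n := by
    intro σ hσ
    simp only [List.mem_toFinset, List.mem_map] at hσ
    obtain ⟨c, hc, rfl⟩ := hσ
    exact (hL.forall_mem c hc).2.1
  have hsub : (⋃ σ ∈ (L.map Prod.fst).toFinset, cyl σ) ⊆ ⋃ σ ∈ A, cyl σ := by
    refine biUnion_subset_biUnion_left fun σ hσ => ?_
    have hσ : σ ∈ (L.map Prod.fst).toFinset := hσ
    simp only [List.mem_toFinset, List.mem_map] at hσ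
    obtain ⟨c, hc, rfl⟩ := hσ
    exact (hL.forall_mem c hc).2.2.2
  refine lt_of_lt_of_le ?_ (measure_mono hsub)
  rw [← ofReal_inv_two_pow, ENNReal.ofReal_lt_iff_lt_toReal (by positivity) (measure_ne_top _ _),
    measure_biUnion_cyl _ hlen, ENNReal.toReal_sum fun _ _ => measure_ne_top _ _,
    List.sum_toFinset _ hL.nodup, List.map_map]
  -- `le_sum` is not strict; strictness comes from the individual conditions, so at least one is
  -- needed.
  have hne : L ≠ [] := by
    rintro rfl
    simpa using hL.le_sum
  have h1 : (L.map fun c => (c.2.2.1 : ℝ) * (N + 1 : ℝ)⁻¹).sum <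
      (L.map ((fun σ => ((μ : Measure Cantor) (cyl σ)).toReal) ∘ Prod.fst)).sum := by
    refine List.sum_lt_sum_of_ne_nil hne _ _ fun c hc => ?_
    have h := hμ c hc
    rw [if_pos (hL.forall_mem c hc).1, (hL.forall_mem c hc).2.2.1] at h
    rwa [div_eq_mul_inv] at h
  refine lt_of_le_of_lt ?_ h1
  have h2 : ((N + 1 : ℕ) : ℝ) ≤ ((2 ^ k * (L.map fun c => c.2.2.1).sum : ℕ) : ℝ) :=
    Nat.cast_le.2 hL.le_sum
  push_cast at h2
  rw [List.map_map] at h2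
  change _ ≤ 2 ^ k * (L.map fun c => (c.2.2.1 : ℝ)).sum at h2
  rw [List.sum_map_mul_right, inv_pow, inv_eq_one_div, ← div_eq_mul_inv,
    div_le_div_iff₀ (by positivity) (by positivity)]
  linarith

theorem exists_isLowerWitness {k : ℕ} {A : Set (List Bool)}
    (hA : ∀ (σ : List Bool) (i : ℕ), σ.take i ∈ A → σ ∈ A) {μ : ProbabilityMeasure Cantor}
    (hμ : 2⁻¹ ^ k < (μ : Measure Cantor) (⋃ σ ∈ A, cyl σ)) :
    ∃ n N L, IsLowerWitness k A n N L ∧ μ ∈ basicOpen L := by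
  classical
  rw [measure_iUnion_cyl _ hA, lt_iSup_iff] at hμ
  obtain ⟨n, hn⟩ := hμ
  set x : List Bool → ℝ := fun σ => (μ : Measure Cantor).real (cyl σ) with hx
  rw [← ofReal_inv_two_pow, ENNReal.ofReal_lt_iff_lt_toReal (by positivity)
    (ENNReal.sum_ne_top.2 fun _ _ => measure_ne_top _ _),
    ENNReal.toReal_sum fun _ _ => measure_ne_top _ _] at hn
  change 2⁻¹ ^ k < ∑ σ ∈ stringsIn A n, x σ at hn
  -- Null cylinders are dropped: they satisfy no strict lower bound `p / (N + 1)` with `p` natural.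
  set S := (stringsIn A n).filter fun σ => 0 < x σ with hS
  have hSx : ∑ σ ∈ S, x σ = ∑ σ ∈ stringsIn A n, x σ :=
    Finset.sum_subset (Finset.filter_subset _ _) fun σ hσ h => by
      have : ¬ 0 < x σ := fun h0 => h (Finset.mem_filter.2 ⟨hσ, h0⟩)
      exact le_antisymm (not_lt.1 this) measureReal_nonneg
  rw [← hSx] at hn
  -- Rounding down costs at most `1 / (N + 1)` per string; this `N` keeps the total loss within the
  -- slack.
  obtain ⟨N, hN⟩ := exists_nat_gt ((S.card : ℝ) / (∑ σ ∈ S, x σ - 2⁻¹ ^ k))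
  have hpos : 0 < ∑ σ ∈ S, x σ - 2⁻¹ ^ k := sub_pos.2 hn
  rw [div_lt_iff₀ hpos] at hN
  -- The largest integer strictly below `x σ * (N + 1)`; on `S` the ceiling is positive, so
  -- truncated subtraction is exact.
  let p : List Bool → ℕ := fun σ => ⌈x σ * (N + 1)⌉₊ - 1
  have hp : ∀ σ ∈ S, (p σ : ℝ) < x σ * (N + 1) ∧ x σ * (N + 1) ≤ p σ + 1 := by
    intro σ hσ
    have h0 : 0 < x σ * (N + 1) := mul_pos (Finset.mem_filter.1 hσ).2 (by positivity)
    have h1 : 1 ≤ ⌈x σ * (N + 1)⌉₊ := Nat.one_le_iff_ne_zero.2 (Nat.ceil_pos.2 h0).ne'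
    have h2 : (p σ : ℝ) = (⌈x σ * (N + 1)⌉₊ : ℝ) - 1 := by
      simp only [p]; push_cast [h1]; ring
    rw [h2]
    exact ⟨by linarith [Nat.ceil_lt_add_one h0.le], by linarith [Nat.le_ceil (x σ * (N + 1))]⟩
  refine ⟨n, N, S.toList.map fun σ => (σ, true, p σ, N), ⟨?_, ?_, ?_⟩, ?_⟩
  · intro c hc
    simp only [List.mem_map, Finset.mem_toList] at hc
    obtain ⟨σ, hσ, rfl⟩ := hc
    have := mem_stringsIn.1 (Finset.mem_filter.1 hσ).1
    exact ⟨rfl, this.1, rfl, this.2⟩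
  · simp [Function.comp_def, Finset.nodup_toList]
  · rw [List.map_map]
    have h1 : (S.toList.map ((fun c : Condition => c.2.2.1) ∘ fun σ => (σ, true, p σ, N))).sum =
        ∑ σ ∈ S, p σ := Finset.sum_map_toList S p
    rw [h1]
    have h2 : ∑ σ ∈ S, x σ * (N + 1) ≤ ∑ σ ∈ S, ((p σ : ℝ) + 1) :=
      Finset.sum_le_sum fun σ hσ => (hp σ hσ).2
    rw [← Finset.sum_mul, Finset.sum_add_distrib, Finset.sum_const, nsmul_eq_mul, mul_one] at h2
    have h3 : (2⁻¹ ^ k : ℝ) * (N + 1) ≤ ∑ σ ∈ S, (p σ : ℝ) := by nlinarith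
    rw [inv_pow, inv_mul_le_iff₀ (by positivity)] at h3
    exact_mod_cast h3
  · intro c hc
    simp only [List.mem_map, Finset.mem_toList] at hc
    obtain ⟨σ, hσ, rfl⟩ := hc
    simp only [if_true]
    rw [div_lt_iff₀ (by positivity)]
    exact (hp σ hσ).1

theorem IsLowerWitness.mono {k : ℕ} {A B : Set (List Bool)} {n N : ℕ} {L : List Condition}
    (hL : IsLowerWitness k A n N L) (h : ∀ c ∈ L, c.1 ∈ A → c.1 ∈ B) :
    IsLowerWitness k B n N L :=
  ⟨fun c hc => have := hL.forall_mem c hc; ⟨this.1, this.2.1, this.2.2.1, h c hc this.2.2.2⟩,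
    hL.nodup, hL.le_sum⟩

/-- The strings that have an initial segment in the `m`-th section of `E`. -/
def extensions (E : ℕ × List Bool → Prop) (m : ℕ) : Set (List Bool) :=
  {σ | ∃ i < σ.length + 1, E (m, σ.take i)}

theorem take_mem_extensions {E : ℕ × List Bool → Prop} {m : ℕ} (σ : List Bool) (i : ℕ)
    (h : σ.take i ∈ extensions E m) : σ ∈ extensions E m := by
  obtain ⟨j, hj, h⟩ := h
  rw [List.take_take] at h
  rw [List.length_take] at hj
  exact ⟨min j i, by omega, h⟩

theorem iUnion_extensions (E : ℕ × List Bool → Prop) (m : ℕ) :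
    ⋃ σ ∈ extensions E m, cyl σ = ⋃ σ, ⋃ (_ : E (m, σ)), cyl σ := by
  refine subset_antisymm (iUnion₂_subset ?_) (iUnion₂_subset fun σ h => ?_)
  · rintro σ ⟨i, -, h⟩
    exact (cyl_subset_cyl_take σ i).trans
      (subset_iUnion₂ (s := fun σ (_ : E (m, σ)) => cyl σ) _ h)
  · exact subset_iUnion₂ (s := fun σ (_ : σ ∈ extensions E m) => cyl σ) σ
      ⟨σ.length, Nat.lt_succ_self _, by rwa [List.take_length]⟩

/-- At a fixed stage, every clause is a bounded check over a list or over prefixes. Unbounded search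
is left only for the stage, `n` and `N`. -/
theorem primrecPred_isLowerWitness (k : ℕ) {E : ℕ → ℕ × List Bool → Prop} (hE : PrimrecRel E) :
    PrimrecPred fun x : (ℕ × List Condition) × (ℕ × ℕ × ℕ) =>
      IsLowerWitness k (extensions (E x.2.1) (x.1.1 + k)) x.2.2.1 x.2.2.2 x.1.2 := by
  have h0 : PrimrecRel fun (c : Condition) (y : ℕ × ℕ × ℕ × ℕ) =>
      c.1 ∈ extensions (E y.2.1) (y.1 + k) := by
    have h : PrimrecRel fun (i : ℕ) (z : Condition × (ℕ × ℕ × ℕ × ℕ)) =>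
        E z.2.2.1 (z.2.1 + k, z.1.1.take i) := by
      refine hE.comp (Primrec.fst.comp (Primrec.snd.comp (Primrec.snd.comp Primrec.snd)))
        (Primrec.pair ?_ ?_)
      · exact Primrec.nat_add.comp (Primrec.fst.comp (Primrec.snd.comp Primrec.snd))
          (Primrec.const k)
      · exact Primrec.list_take.comp Primrec.fst
          (Primrec.fst.comp (Primrec.fst.comp Primrec.snd))
    exact (h.exists_mem_list.comp (Primrec.list_range.comp (Primrec.succ.comp
      (Primrec.list_length.comp (Primrec.fst.comp Primrec.fst)))) Primrec.id).of_eq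
      fun z => by simp [extensions]
  have h1 : PrimrecRel fun (c : Condition) (y : ℕ × ℕ × ℕ × ℕ) =>
      c.2.1 = true ∧ c.1.length = y.2.2.1 ∧ c.2.2.2 = y.2.2.2 ∧
        c.1 ∈ extensions (E y.2.1) (y.1 + k) := by
    refine PrimrecPred.and (PrimrecRel.comp Primrec.eq ?_ (Primrec.const true))
      (PrimrecPred.and (PrimrecRel.comp Primrec.eq ?_ ?_)
        (PrimrecPred.and (PrimrecRel.comp Primrec.eq ?_ ?_) h0))
    · exact Primrec.fst.comp (Primrec.snd.comp Primrec.fst)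
    · exact Primrec.list_length.comp (Primrec.fst.comp Primrec.fst)
    · exact Primrec.fst.comp (Primrec.snd.comp (Primrec.snd.comp Primrec.snd))
    · exact Primrec.snd.comp (Primrec.snd.comp (Primrec.snd.comp Primrec.fst))
    · exact Primrec.snd.comp (Primrec.snd.comp (Primrec.snd.comp Primrec.snd))
  have h3 : Primrec fun l : List ℕ => l.sum :=
    (Primrec.list_foldr Primrec.id (Primrec.const 0)
      (Primrec.nat_add.comp (Primrec.fst.comp Primrec.snd)
        (Primrec.snd.comp Primrec.snd)).to₂).of_eq
      fun l => List.sum_eq_foldr.symm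
  have hL : Primrec fun x : (ℕ × List Condition) × (ℕ × ℕ × ℕ) => x.1.2 :=
    Primrec.snd.comp Primrec.fst
  have h4 : PrimrecPred fun x : (ℕ × List Condition) × (ℕ × ℕ × ℕ) =>
      (x.1.2.map Prod.fst).Nodup :=
    (primrecPred_nodup []).comp (Primrec.list_map hL (Primrec.fst.comp Primrec.snd))
  have h5 : PrimrecPred fun x : (ℕ × List Condition) × (ℕ × ℕ × ℕ) =>
      x.2.2.2 + 1 ≤ 2 ^ k * (x.1.2.map fun c => c.2.2.1).sum :=
    PrimrecRel.comp Primrec.nat_le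
      (Primrec.succ.comp (Primrec.snd.comp (Primrec.snd.comp Primrec.snd)))
      (Primrec.nat_mul.comp (Primrec.const _) (h3.comp (Primrec.list_map hL
        (Primrec.fst.comp (Primrec.snd.comp (Primrec.snd.comp Primrec.snd))))))
  have h6 := h1.forall_mem_list.comp hL
    ((Primrec.fst.comp Primrec.fst).pair Primrec.snd)
  exact (h6.and (h4.and h5)).of_eq fun x =>
    ⟨fun h => ⟨h.1, h.2.1, h.2.2⟩, fun h => ⟨h.1, h.2, h.3⟩⟩

theorem UniformlySigma1.setOf_lt {G : ℕ → Set Cantor} (hG : UniformlySigma1 cyl G) (k : ℕ) :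
    UniformlySigma1 basicOpen fun m => {μ | 2⁻¹ ^ k < (μ : Measure Cantor) (G (m + k))} := by
  obtain ⟨W, hW, hGW⟩ := hG
  obtain ⟨E, hE, hmono, hWE⟩ := hW.exists_stages
  have hsub : ∀ s m, extensions (E s) m ⊆ extensions W m := fun s m σ ⟨i, hi, h⟩ =>
    ⟨i, hi, (hWE _).2 ⟨s, h⟩⟩
  refine ⟨_, (primrecPred_isLowerWitness k hE).rePred_exists, fun m => ?_⟩
  ext μ
  simp only [hGW, ← iUnion_extensions, mem_iUnion, exists_prop]
  constructor
  · intro hμ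
    obtain ⟨n, N, L, hL, hμL⟩ := exists_isLowerWitness take_mem_extensions hμ
    have : ∀ c ∈ L, ∃ s, c.1 ∈ extensions (E s) (m + k) := by
      intro c hc
      obtain ⟨i, hi, h⟩ := (hL.forall_mem c hc).2.2.2
      obtain ⟨s, hs⟩ := (hWE _).1 h
      exact ⟨s, i, hi, hs⟩
    choose! s hs using this
    -- Finitely many strings, so one stage enumerates the needed prefixes of all of them.
    obtain ⟨t, ht⟩ := (L.map s).toFinset.exists_le
    refine ⟨L, ⟨(t, n, N), hL.mono fun c hc _ => ?_⟩, hμL⟩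
    obtain ⟨i, hi, h⟩ := hs c hc
    exact ⟨i, hi, hmono (ht _ (List.mem_toFinset.2 (List.mem_map_of_mem hc))) h⟩
  · rintro ⟨L, ⟨⟨s, n, N⟩, hL⟩, hμL⟩
    exact (hL.mono fun c _ h => hsub s _ h).lt_measure hμL

theorem UniformlySigma1.isOpen {G : ℕ → Set Cantor} (hG : UniformlySigma1 cyl G) (m : ℕ) :
    IsOpen (G m) := by
  obtain ⟨W, -, hGW⟩ := hG
  rw [hGW]
  exact isOpen_iUnion fun σ => isOpen_iUnion fun _ => isOpen_cyl σ

/-! ### Turning a failed λ-test into a ℙ-test -/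

theorem IsMLRandom.isMLAbsolutelyContinuous {μ : ProbabilityMeasure Cantor}
    (hμ : IsMLRandom basicOpen naturalMeasure μ) :
    IsMLAbsolutelyContinuous (μ : Measure Cantor) := by
  intro G hG
  by_contra h0
  obtain ⟨k, hk⟩ := ENNReal.exists_inv_two_pow_lt h0
  -- The index shift by `k` absorbs the factor `2 ^ k` from Markov's inequality.
  refine hμ _ ⟨UniformlySigma1.setOf_lt hG.1 k, fun m => ?_⟩
    (mem_iInter.2 fun m => lt_of_lt_of_le hk (iInf_le _ (m + k)))
  calc _ ≤ 2 ^ k * uniformMeasure (G (m + k)) :=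
        naturalMeasure_setOf_lt_le (UniformlySigma1.isOpen hG.1 _) k
    _ ≤ 2 ^ k * 2⁻¹ ^ (m + k) := by gcongr; exact hG.2 _
    _ = 2⁻¹ ^ m := by
        rw [pow_add, mul_left_comm, ← mul_pow, ENNReal.mul_inv_cancel (by simp) (by simp),
          one_pow, mul_one]

end CantorRandom

theorem mainTheorem11 :
    (∀ G : Set CantorRandom.Cantor, IsOpen G →
      ∫⁻ μ, (μ : MeasureTheory.Measure CantorRandom.Cantor) G ∂CantorRandom.naturalMeasure =
        CantorRandom.uniformMeasure G) ∧
    ∀ μ : MeasureTheory.ProbabilityMeasure CantorRandom.Cantor,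
      CantorRandom.IsMLRandom CantorRandom.basicOpen CantorRandom.naturalMeasure μ →
        CantorRandom.IsMLAbsolutelyContinuous
          (μ : MeasureTheory.Measure CantorRandom.Cantor) :=
  ⟨fun _ hG => CantorRandom.lintegral_naturalMeasure hG,
    fun _ hμ => hμ.isMLAbsolutelyContinuous⟩
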